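/- Let $H$ be a complex Hilbert space of finite dimension $n$ and let $\{e_{ij}\}_{i,j=1}^n$ be a system of matrix units in the operators on $H$, that is, $e_{ij}e_{kl}=\delta_{jk}e_{il}$ and $\sum_{i=1}^n e_{ii}=1$. Let $\lambda_1,\dots,\lambda_n$ and $h_{ij}$ ($i,j=1,\dots,n$) be complex numbers and put \[ x=\sum_{i=1}^n\lambda_i e_{ii},\qquad h=\sum_{i,j=1}^n h_{ij}e_{ij}. \] Then the function $t\mapsto \operatorname{tr}\exp(x+th)$ of the real variable $t$ is infinitely differentiable, and for every integer $p\ge 1$ \[ \frac{d^p}{dt^p}\operatorname{tr}\exp(x+th)\Big|_{t=0} =p!\sum_{i_1=1}^n\cdots\sum_{i_p=1}^n h_{i_pi_{p-1}}\cdots h_{i_2i_1}h_{i_1i_p}\,[\lambda_{i_1},\lambda_{i_2},\dots,\lambda_{i_p},\lambda_{i_p}]_{\exp}. \] Here $[x_0,\dots,x_m]_f$ denotes the divided difference of an entire function $f$ at $m+1$ not necessarily distinct points of $\mathbb{C}$ (so the ones above are of order $p+1$, that is, taken at $p+1$ points), given by $[x_0]_f=f(x_0)$ and $[x_0,x_1,\dots,x_m]_f=[x_1,\dots,x_m]_g$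 for $m\ge 1$, where $g(z)=\frac{f(z)-f(x_0)}{z-x_0}$ for $z\ne x_0$ and $g(x_0)=f'(x_0)$. -/

import Mathlib

/-- The divided difference `[x₀, x₁, …, xₘ]_f` of a function `f : ℂ → ℂ`, the points being given
as a list and not necessarily distinct. It is Newton's recursion
`[x]_f = f x`, `[x₀, x₁, …, xₘ]_f = [x₁, …, xₘ]_g`, where `g z = [x₀, z]_f` is
`(f z - f x₀) / (z - x₀)` for `z ≠ x₀` and is extended by the derivative `f' x₀` to `z = x₀`
(this `g` is Mathlib's `dslope f x₀`). The value at the empty list is a placeholder. -/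
noncomputable def dividedDifference : (ℂ → ℂ) → List ℂ → ℂ
  | _, [] => 0
  | f, [x] => f x
  | f, x :: y :: l => dividedDifference (dslope f x) (y :: l)

/-- `e` is a (complete) system of `n × n` matrix units in the ring `A`:
`e i j * e k l = δ j k • e i l` and `∑ i, e i i = 1`.
In an algebra with involution one often also asks for `star (e i j) = e j i`; this is not needed,
so both readings are covered. -/
structure IsMatrixUnits {n : ℕ} {A : Type*} [Ring A] (e : Fin n → Fin n → A) : Prop where
  mul_eq : ∀ i j k l, e i j * e k l = if j = k then e i l else 0
  sum_diag : ∑ i, e i i = 1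

/-!
Let `f` be entire and `X = x + t • h`. Substituting `X` into the identity
`f w = f z + (dslope f z) w * (w - z)` with `z = λ_a`, and multiplying by the matrix unit `e a b`,
which is an eigenvector of left multiplication by `x`, gives
`f(X) e_{ab} = f(λ_a) e_{ab} + t ∑_d h_{da} (dslope f λ_a)(X) e_{db}`.
This is Newton's recursion for divided differences: differentiating `p` times at `t = 0` gives `p!`
times a sum over the index paths `a = j₀, j₁, …, j_p` with weight `h_{j_p j_{p-1}} ⋯ h_{j₁ j₀}` and
coefficient `[λ_{j₀}, …, λ_{j_p}]_f`. The trace selects the closed paths, `j_p = j₀`, and the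
symmetry of divided differences moves the repeated point to the end of the list.
-/

open scoped Nat
open Matrix (vecCons)

theorem differentiable_dslope {E : Type*} [NormedAddCommGroup E] [NormedSpace ℂ E]
    [CompleteSpace E] {f : ℂ → E} (hf : Differentiable ℂ f) (x : ℂ) :
    Differentiable ℂ (dslope f x) := by
  simpa only [differentiableOn_univ] using
    (Complex.differentiableOn_dslope Filter.univ_mem).mpr hf.differentiableOn

theorem dslope_comm {𝕜 E : Type*} [NontriviallyNormedField 𝕜] [NormedAddCommGroup E]
    [NormedSpace 𝕜 E] (f : 𝕜 → E) (x y : 𝕜) : dslope f x y = dslope f y x := by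
  obtain rfl | hxy := eq_or_ne x y
  · rfl
  · rw [dslope_of_ne f hxy.symm, dslope_of_ne f hxy, slope_comm]

theorem dslope_dslope_comm {f : ℂ → ℂ} (hf : Differentiable ℂ f) (x y : ℂ) :
    dslope (dslope f x) y = dslope (dslope f y) x := by
  obtain rfl | hxy := eq_or_ne x y
  · rfl
  have continuous_dslope_dslope (a b : ℂ) : Continuous (dslope (dslope f a) b) :=
    (differentiable_dslope (differentiable_dslope hf a) b).continuous
  refine (continuous_dslope_dslope x y).ext_on
    ((Set.toFinite {x, y}).countable.dense_compl ℝ) (continuous_dslope_dslope y x) fun z hz => ?_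
  simp only [Set.mem_compl_iff, Set.mem_insert_iff, Set.mem_singleton_iff, not_or] at hz
  obtain ⟨hzx, hzy⟩ := hz
  simp only [dslope_of_ne _ hzx, dslope_of_ne _ hzy, dslope_of_ne _ hxy, dslope_of_ne _ hxy.symm,
    slope_def_field]
  have hzx_sub := sub_ne_zero.2 hzx
  have hzy_sub := sub_ne_zero.2 hzy
  have hxy_sub := sub_ne_zero.2 hxy
  have hyx_sub := sub_ne_zero.2 hxy.symm
  field_simp
  ring

theorem dividedDifference_perm {l l' : List ℂ} (hl : l.Perm l') {f : ℂ → ℂ}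
    (hf : Differentiable ℂ f) : dividedDifference f l = dividedDifference f l' := by
  induction hl generalizing f with
  | nil => rfl
  | @cons x l l' hl ih =>
    cases l with
    | nil => rw [hl.nil_eq]
    | cons y m =>
      cases l' with
      | nil => exact absurd hl.eq_nil (List.cons_ne_nil y m)
      | cons y' m' => exact ih (differentiable_dslope hf x)
  | swap x y l =>
    cases l with
    | nil => exact dslope_comm f y x
    | cons z m => simp only [dividedDifference, dslope_dslope_comm hf x y]
  | trans _ _ ih ih' => exact (ih hf).trans (ih' hf)

theorem iteratedDeriv_succ_id_smul_zero {𝕜 E : Type*} [NontriviallyNormedField 𝕜]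
    [NormedAddCommGroup E] [NormedSpace 𝕜 E] {g : 𝕜 → E} {n : ℕ} (hg : ContDiff 𝕜 (n + 1) g) :
    iteratedDeriv (n + 1) (fun t => t • g t) 0 = (n + 1) • iteratedDeriv n g 0 := by
  have leibniz := iteratedDerivWithin_smul (n := n + 1) (Set.mem_univ (0 : 𝕜)) uniqueDiffOn_univ
    (contDiff_id.contDiffWithinAt (f := id)) hg.contDiffWithinAt
  simp only [iteratedDerivWithin_univ] at leibniz
  refine leibniz.trans ?_
  rw [Finset.sum_eq_single 1]
  · simp [iteratedDeriv_id]
  · intro k _ hk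
    simp [iteratedDeriv_id, hk]
  · simp

theorem iteratedDeriv_clm_comp {𝕜 E F : Type*} [NontriviallyNormedField 𝕜]
    [NormedAddCommGroup E] [NormedSpace 𝕜 E] [NormedAddCommGroup F] [NormedSpace 𝕜 F]
    (L : E →L[𝕜] F) {g : 𝕜 → E} {n : ℕ} (hg : ContDiff 𝕜 n g) (t : 𝕜) :
    iteratedDeriv n (fun s => L (g s)) t = L (iteratedDeriv n g t) := by
  simp only [iteratedDeriv_eq_iteratedFDeriv]
  exact DFunLike.congr_fun (L.iteratedFDeriv_comp_left hg.contDiffAt le_rfl) fun _ => 1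

theorem iteratedDeriv_comp_ofReal {E : Type*} [NormedAddCommGroup E] [NormedSpace ℂ E]
    {F : ℂ → E} (n : ℕ) (hF : ContDiff ℂ n F) :
    iteratedDeriv n (fun t : ℝ => F t) = fun t : ℝ => iteratedDeriv n F t := by
  induction n with
  | zero => simp only [iteratedDeriv_zero]
  | succ n ih =>
    ext t
    rw [iteratedDeriv_succ, iteratedDeriv_succ, ih (hF.of_le (by gcongr; simp))]
    have hasDerivAt_iteratedDeriv :=
      (hF.differentiable_iteratedDeriv n (by exact_mod_cast n.lt_succ_self) t).hasDerivAt
    simpa only [Function.comp_def, Complex.ofRealCLM_apply, Complex.ofReal_one, one_smul] using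
      (hasDerivAt_iteratedDeriv.scomp t Complex.ofRealCLM.hasDerivAt).deriv

/-- The entire functional calculus `X ↦ f(X)` in a complex Banach algebra, defined as the sum of the
Taylor series of `f` at `0`; its values are meaningful only where that series converges, in
particular everywhere if `f` is entire. -/
noncomputable def entireEval {A : Type*} [NormedRing A] [NormedAlgebra ℂ A] (f : ℂ → ℂ) :
    A → A :=
  FormalMultilinearSeries.ofScalarsSum fun k => (k ! : ℂ)⁻¹ * iteratedDeriv k f 0

section EntireEval

variable {A : Type*} [NormedRing A] [NormedAlgebra ℂ A]

theorem entireEval_exp : entireEval Complex.exp = (NormedSpace.exp : A → A) := by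
  simp [NormedSpace.exp_eq_ofScalarsSum ℂ, entireEval, iteratedDeriv_eq_iterate]

variable [CompleteSpace A] {f : ℂ → ℂ}

theorem hasFPowerSeriesOnBall_entireEval (hf : Differentiable ℂ f) :
    HasFPowerSeriesOnBall (entireEval f : A → A)
      (FormalMultilinearSeries.ofScalars A fun k => (k ! : ℂ)⁻¹ * iteratedDeriv k f 0) 0 ⊤ := by
  have radius_eq_top : (FormalMultilinearSeries.ofScalars A
      fun k => (k ! : ℂ)⁻¹ * iteratedDeriv k f 0).radius = ⊤ := by
    refine FormalMultilinearSeries.radius_eq_top_of_summable_norm _ fun r => ?_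
    have taylor_summable := (Complex.hasSum_taylorSeries_of_entire hf 0 (r : ℂ)).summable
    refine .of_nonneg_of_le (fun k => by positivity) (fun k => ?_)
      (taylor_summable.norm.mul_left (max 1 ‖(1 : A)‖))
    calc _ ≤ ‖(k ! : ℂ)⁻¹ * iteratedDeriv k f 0‖ * max 1 ‖(1 : A)‖ * r ^ k := by
          gcongr
          rw [FormalMultilinearSeries.ofScalars, norm_smul]
          gcongr
          exact ContinuousMultilinearMap.norm_mkPiAlgebraFin_le
      _ = _ := by
          simp
          ring
  exact radius_eq_top ▸ FormalMultilinearSeries.hasFPowerSeriesOnBall _ (by simp [radius_eq_top])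

theorem contDiff_entireEval (hf : Differentiable ℂ f) {n : WithTop ℕ∞} :
    ContDiff ℂ n (entireEval f : A → A) := by
  have analytic := (hasFPowerSeriesOnBall_entireEval (A := A) hf).analyticOnNhd
  rw [Metric.eball_top] at analytic
  exact analytic.contDiff

theorem contDiff_entireEval_line (hf : Differentiable ℂ f) (x h : A) {n : WithTop ℕ∞} :
    ContDiff ℂ n fun t : ℂ => entireEval f (x + t • h) :=
  (contDiff_entireEval hf).comp (contDiff_const.add (contDiff_id.smul contDiff_const))

theorem hasSum_entireEval (hf : Differentiable ℂ f) (X : A) :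
    HasSum (fun k => ((k ! : ℂ)⁻¹ * iteratedDeriv k f 0) • X ^ k) (entireEval f X) := by
  simpa only [FormalMultilinearSeries.ofScalars_apply_eq, zero_add] using
    (hasFPowerSeriesOnBall_entireEval (A := A) hf).hasSum (y := X) (by simp)

theorem entireEval_const (z : ℂ) (X : A) : entireEval (fun _ => z) X = algebraMap ℂ A z := by
  refine (hasSum_entireEval (differentiable_const z) X).unique ?_
  convert hasSum_single 0 fun k hk => ?_ using 1
  · simp [Algebra.algebraMap_eq_smul_one]
  · simp [iteratedDeriv_const, hk]

theorem entireEval_add (hf : Differentiable ℂ f) {g : ℂ → ℂ} (hg : Differentiable ℂ g) (X : A) :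
    entireEval (f + g) X = entireEval f X + entireEval g X := by
  refine (hasSum_entireEval (hf.add hg) X).unique
    (((hasSum_entireEval hf X).add (hasSum_entireEval hg X)).congr_fun fun k => ?_)
  rw [iteratedDeriv_add hf.contDiff.contDiffAt hg.contDiff.contDiffAt, mul_add, add_smul]

theorem entireEval_smul (hf : Differentiable ℂ f) (z : ℂ) (X : A) :
    entireEval (z • f) X = z • entireEval f X := by
  refine (hasSum_entireEval (hf.const_smul z) X).unique
    (((hasSum_entireEval hf X).const_smul z).congr_fun fun k => ?_)
  rw [iteratedDeriv_const_smul hf.contDiff.contDiffAt, smul_smul, smul_eq_mul, mul_left_comm]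

theorem entireEval_id_smul (hf : Differentiable ℂ f) (X : A) :
    entireEval (fun w => w • f w) X = entireEval f X * X := by
  have hid : Differentiable ℂ fun w => w • f w := differentiable_fun_id.smul hf
  refine (hasSum_entireEval hid X).unique ((hasSum_nat_add_iff' 1).mp ?_)
  simp only [Finset.sum_range_one, iteratedDeriv_zero, zero_smul, mul_zero, sub_zero]
  refine ((hasSum_entireEval hf X).mul_right X).congr_fun fun k => ?_
  have cast_succ_ne_zero : (k + 1 : ℂ) ≠ 0 := k.cast_add_one_ne_zero
  rw [iteratedDeriv_succ_id_smul_zero hf.contDiff, smul_mul_assoc, ← pow_succ, Nat.factorial_succ,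
    nsmul_eq_mul]
  push_cast
  field_simp

theorem entireEval_eq_add_dslope (hf : Differentiable ℂ f) (X : A) (z : ℂ) :
    entireEval f X =
      algebraMap ℂ A (f z) + entireEval (dslope f z) X * (X - algebraMap ℂ A z) := by
  have hdf := differentiable_dslope hf z
  have newton : f = (fun _ => f z) + ((fun w => w • dslope f z w) + (-z) • dslope f z) := by
    ext w
    simp only [Pi.add_apply, Pi.smul_apply, ← add_smul, ← sub_eq_add_neg, sub_smul_dslope,
      add_sub_cancel]
  have hid : Differentiable ℂ fun w => w • dslope f z w := differentiable_fun_id.smul hdf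
  conv_lhs => rw [newton]
  rw [entireEval_add (differentiable_const _) (hid.add (hdf.const_smul _)), entireEval_const,
    entireEval_add hid (hdf.const_smul _), entireEval_id_smul hdf, entireEval_smul hdf, mul_sub,
    ← Algebra.commutes, ← Algebra.smul_def, neg_smul, ← sub_eq_add_neg]

theorem entireEval_mul (hf : Differentiable ℂ f) (X u : A) (z : ℂ) :
    entireEval f X * u = f z • u + entireEval (dslope f z) X * (X * u - z • u) := by
  rw [entireEval_eq_add_dslope hf X z, add_mul, mul_assoc, sub_mul, ← Algebra.smul_def,
    ← Algebra.smul_def]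

end EntireEval

/-- The weight `c (j p) (j (p - 1)) * ⋯ * c (j 1) (j 0)` of the path `j 0, j 1, …, j p` of indices,
where the matrix entry `c b a` is the weight of the step from `a` to `b`. -/
def pathWeight {R ι : Type*} [CommMonoid R] (c : ι → ι → R) {p : ℕ} (j : Fin (p + 1) → ι) : R :=
  ∏ k : Fin p, c (j k.succ) (j k.castSucc)

theorem pathWeight_vecCons {R ι : Type*} [CommMonoid R] (c : ι → ι → R) {p : ℕ} (a : ι)
    (j : Fin (p + 1) → ι) : pathWeight c (vecCons a j) = c (j 0) a * pathWeight c j := by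
  simp [pathWeight, Fin.prod_univ_succ]

theorem sum_vecCons {ι M : Type*} [Fintype ι] [AddCommMonoid M] {p : ℕ}
    (F : (Fin (p + 1) → ι) → M) : ∑ j, F j = ∑ d, ∑ i : Fin p → ι, F (vecCons d i) := by
  rw [← (Fin.consEquiv fun _ => ι).sum_comp, Fintype.sum_prod_type]
  rfl

/-- The sum of `[lam (j 0), …, lam (j p)]_f • v (j p)` over all paths `j` of length `p` starting at
`j 0 = a`, weighted by `pathWeight c j`. It is the `p`-th Taylor coefficient in `t` of
`f(x + t h) v_a` when `x` and `h` act on the vectors `v` by `diag lam` and by `c`. -/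
noncomputable def pathSum {ι M : Type*} [Fintype ι] [AddCommMonoid M] [Module ℂ M]
    (c : ι → ι → ℂ) (lam : ι → ℂ) (v : ι → M) (f : ℂ → ℂ) (p : ℕ) (a : ι) : M :=
  ∑ i : Fin p → ι, (pathWeight c (vecCons a i) *
    dividedDifference f (lam a :: List.ofFn (lam ∘ i))) • v (vecCons a i (Fin.last p))

section PathSum

variable {ι M : Type*} [Fintype ι] [AddCommMonoid M] [Module ℂ M] (c : ι → ι → ℂ) (lam : ι → ℂ)
  (v : ι → M) (f : ℂ → ℂ)

theorem pathSum_zero (a : ι) : pathSum c lam v f 0 a = f (lam a) • v a := by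
  simp [pathSum, pathWeight, dividedDifference]

theorem pathSum_succ (p : ℕ) (a : ι) :
    pathSum c lam v f (p + 1) a =
      ∑ d, c d a • pathSum c lam v (dslope f (lam a)) p d := by
  simp only [pathSum, sum_vecCons, Finset.smul_sum, smul_smul, pathWeight_vecCons,
    Matrix.cons_val_zero, ← Fin.succ_last, Matrix.cons_val_succ, mul_assoc, List.ofFn_succ,
    Function.comp_apply, dividedDifference]
  rfl

end PathSum

theorem iteratedDeriv_entireEval_mul {A ι : Type*} [NormedRing A] [NormedAlgebra ℂ A]
    [CompleteSpace A] [Fintype ι] {x h : A} {v : ι → A} {lam : ι → ℂ} {c : ι → ι → ℂ}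
    (hx : ∀ a, x * v a = lam a • v a) (hh : ∀ a, h * v a = ∑ d, c d a • v d)
    {f : ℂ → ℂ} (hf : Differentiable ℂ f) (p : ℕ) (a : ι) :
    iteratedDeriv p (fun t : ℂ => entireEval f (x + t • h) * v a) 0 =
      p ! • pathSum c lam v f p a := by
  have contDiff_mul {g : ℂ → ℂ} (hg : Differentiable ℂ g) (d : ι) (m : WithTop ℕ∞) :
      ContDiff ℂ m fun t : ℂ => entireEval g (x + t • h) * v d :=
    (contDiff_entireEval_line hg x h).mul contDiff_const
  have newton (t : ℂ) {g : ℂ → ℂ} (hg : Differentiable ℂ g) (d : ι) :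
      entireEval g (x + t • h) * v d = g (lam d) • v d +
        t • ∑ b, c b d • (entireEval (dslope g (lam d)) (x + t • h) * v b) := by
    simp only [entireEval_mul hg _ _ (lam d), add_mul, hx, smul_mul_assoc, hh,
      add_sub_cancel_left, mul_smul_comm, Finset.mul_sum]
  induction p generalizing f a with
  | zero => simpa [pathSum_zero] using newton 0 hf a
  | succ p ih =>
    have hdf := differentiable_dslope hf (lam a)
    have contDiff_term (b : ι) (m : WithTop ℕ∞) := (contDiff_mul hdf b m).const_smul (c b a)
    simp only [newton _ hf]
    rw [iteratedDeriv_const_add p.succ_pos,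
      iteratedDeriv_succ_id_smul_zero (.sum fun b _ => contDiff_term b _),
      iteratedDeriv_fun_sum fun b _ => (contDiff_term b _).contDiffAt, pathSum_succ,
      Nat.factorial_succ, mul_smul, Finset.smul_sum]
    simp only [iteratedDeriv_fun_const_smul (contDiff_mul hdf _ _).contDiffAt, ih hdf,
      smul_comm (p !), Finset.smul_sum]

section MatrixUnits

variable {K A : Type*} [Ring A] {n : ℕ} {e : Fin n → Fin n → A}

theorem IsMatrixUnits.sum_diag_mul [CommSemiring K] [Algebra K A] (he : IsMatrixUnits e)
    (lam : Fin n → K) (a b : Fin n) : (∑ i, lam i • e i i) * e a b = lam a • e a b := by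
  simp [Finset.sum_mul, he.mul_eq]

theorem IsMatrixUnits.sum_mul [CommSemiring K] [Algebra K A] (he : IsMatrixUnits e)
    (c : Fin n → Fin n → K) (a b : Fin n) :
    (∑ i, ∑ j, c i j • e i j) * e a b = ∑ d, c d a • e d b := by
  simp [Finset.sum_mul, he.mul_eq]

theorem IsMatrixUnits.trace_apply [Field K] [CharZero K] [Algebra K A] (he : IsMatrixUnits e)
    {τ : A →ₗ[K] K} (hτ : ∀ a b, τ (a * b) = τ (b * a)) (hτ_one : τ 1 = n) (i j : Fin n) :
    τ (e i j) = if i = j then 1 else 0 := by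
  split_ifs with hij
  · subst hij
    have diag_eq (k : Fin n) : τ (e k k) = τ (e i i) := by
      simpa [he.mul_eq] using hτ (e k i) (e i k)
    have cast_n_ne_zero : (n : K) ≠ 0 := Nat.cast_ne_zero.mpr i.pos.ne'
    simpa [← he.sum_diag, diag_eq, cast_n_ne_zero] using hτ_one
  · simpa [he.mul_eq, Ne.symm hij] using hτ (e i j) (e j j)

end MatrixUnits

theorem sum_trace_pathSum {A : Type*} [AddCommMonoid A] [Module ℂ A] {ι : Type*} [Fintype ι]
    [DecidableEq ι] {e : ι → ι → A} {τ : A →ₗ[ℂ] ℂ}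
    (hτ : ∀ i j, τ (e i j) = if i = j then 1 else 0) {f : ℂ → ℂ} (hf : Differentiable ℂ f)
    (lam : ι → ℂ) (c : ι → ι → ℂ) (p : ℕ) :
    ∑ a, τ (pathSum c lam (fun d => e d a) f (p + 1) a) =
      ∑ i : Fin (p + 1) → ι, pathWeight c i * c (i 0) (i (Fin.last p)) *
        dividedDifference f (List.ofFn (lam ∘ i) ++ [lam (i (Fin.last p))]) := by
  simp only [pathSum, map_sum, map_smul, hτ, smul_eq_mul, mul_ite, mul_one, mul_zero]
  rw [Finset.sum_comm]
  refine Finset.sum_congr rfl fun i _ => ?_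
  simp only [← Fin.succ_last, Matrix.cons_val_succ, Finset.sum_ite_eq, Finset.mem_univ, if_true,
    pathWeight_vecCons, mul_comm (c _ _)]
  rw [dividedDifference_perm (List.perm_append_singleton _ _) hf]

theorem iteratedDeriv_trace_entireEval {A : Type*} [NormedRing A] [NormedAlgebra ℂ A]
    [CompleteSpace A] {n : ℕ} {e : Fin n → Fin n → A} (he : IsMatrixUnits e) {τ : A →L[ℂ] ℂ}
    (hτ : ∀ i j, τ (e i j) = if i = j then 1 else 0) {f : ℂ → ℂ} (hf : Differentiable ℂ f)
    (lam : Fin n → ℂ) (c : Fin n → Fin n → ℂ) {x h : A} (hx : x = ∑ i, lam i • e i i)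
    (hh : h = ∑ i, ∑ j, c i j • e i j) (p : ℕ) :
    iteratedDeriv (p + 1) (fun t : ℂ => τ (entireEval f (x + t • h))) 0 =
      ((p + 1)! : ℂ) * ∑ i : Fin (p + 1) → Fin n,
        pathWeight c i * c (i 0) (i (Fin.last p)) *
          dividedDifference f (List.ofFn (lam ∘ i) ++ [lam (i (Fin.last p))]) := by
  have contDiff_eval (m : WithTop ℕ∞) : ContDiff ℂ m fun t : ℂ => entireEval f (x + t • h) :=
    contDiff_entireEval_line hf x h
  have contDiff_column (a : Fin n) : ContDiff ℂ _ fun t : ℂ => entireEval f (x + t • h) * e a a :=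
    (contDiff_eval (p + 1 : ℕ)).mul contDiff_const
  have sum_columns (t : ℂ) :
      entireEval f (x + t • h) = ∑ a, entireEval f (x + t • h) * e a a := by
    rw [← Finset.mul_sum, he.sum_diag, mul_one]
  have deriv_column (a : Fin n) := iteratedDeriv_entireEval_mul (v := fun d => e d a)
    (fun d => hx ▸ he.sum_diag_mul lam d a) (fun d => hh ▸ he.sum_mul c d a) hf (p + 1) a
  rw [iteratedDeriv_clm_comp τ (contDiff_eval _), funext sum_columns,
    iteratedDeriv_fun_sum fun a _ => (contDiff_column a).contDiffAt]
  simp only [deriv_column]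
  rw [← Finset.smul_sum, map_nsmul, map_sum, nsmul_eq_mul]
  exact congrArg _ (sum_trace_pathSum (τ := τ.toLinearMap) hτ hf lam c p)

theorem mainTheorem3_general {A : Type*} [NormedRing A] [NormedAlgebra ℂ A]
    [CompleteSpace A] {n : ℕ} {e : Fin n → Fin n → A} (he : IsMatrixUnits e) {τ : A →L[ℂ] ℂ}
    (hτ : ∀ i j, τ (e i j) = if i = j then 1 else 0) {f : ℂ → ℂ} (hf : Differentiable ℂ f)
    (lam : Fin n → ℂ) (c : Fin n → Fin n → ℂ) {x h : A} (hx : x = ∑ i, lam i • e i i)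
    (hh : h = ∑ i, ∑ j, c i j • e i j) (p : ℕ) :
    ContDiff ℝ ((⊤ : ℕ∞) : WithTop ℕ∞) (fun t : ℝ => τ (entireEval f (x + (t : ℂ) • h))) ∧
    iteratedDeriv (p + 1) (fun t : ℝ => τ (entireEval f (x + (t : ℂ) • h))) 0 =
      ((p + 1)! : ℂ) * ∑ i : Fin (p + 1) → Fin n,
        ((∏ k : Fin p, c (i k.succ) (i k.castSucc)) * c (i 0) (i (Fin.last p))) *
          dividedDifference f (List.ofFn (fun k => lam (i k)) ++ [lam (i (Fin.last p))]) := by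
  have contDiff_trace (m : WithTop ℕ∞) :
      ContDiff ℂ m fun t : ℂ => τ (entireEval f (x + t • h)) :=
    τ.contDiff.comp (contDiff_entireEval_line hf x h)
  exact ⟨((contDiff_trace _).restrict_scalars ℝ).comp Complex.ofRealCLM.contDiff,
    (congrFun (iteratedDeriv_comp_ofReal (p + 1) (contDiff_trace _)) 0).trans
      (iteratedDeriv_trace_entireEval he hτ hf lam c hx hh p)⟩

/-- The trace of operators on a finite-dimensional normed space as a continuous linear functional,
so that it commutes with differentiation. -/
noncomputable def operatorTrace (H : Type*) [NormedAddCommGroup H] [NormedSpace ℂ H]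
    [FiniteDimensional ℂ H] : (H →L[ℂ] H) →L[ℂ] ℂ :=
  LinearMap.toContinuousLinearMap (LinearMap.trace ℂ H ∘ₗ ContinuousLinearMap.coeLM ℂ)

theorem IsMatrixUnits.operatorTrace_apply {H : Type*} [NormedAddCommGroup H] [NormedSpace ℂ H]
    [FiniteDimensional ℂ H] {n : ℕ} {e : Fin n → Fin n → (H →L[ℂ] H)} (he : IsMatrixUnits e)
    (hn : Module.finrank ℂ H = n) (i j : Fin n) :
    operatorTrace H (e i j) = if i = j then 1 else 0 :=
  he.trace_apply (τ := (operatorTrace H).toLinearMap)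
    (fun a b => LinearMap.trace_mul_comm ℂ (a : H →ₗ[ℂ] H) b)
    ((LinearMap.trace_one ℂ H).trans (by rw [hn])) i j

theorem mainTheorem3 {H : Type*} [NormedAddCommGroup H] [InnerProductSpace ℂ H]
    [FiniteDimensional ℂ H] (n : ℕ) (hn : Module.finrank ℂ H = n)
    (e : Fin n → Fin n → (H →L[ℂ] H)) (he : IsMatrixUnits e)
    (lam : Fin n → ℂ) (c : Fin n → Fin n → ℂ) (x h : H →L[ℂ] H)
    (hx : x = ∑ i, lam i • e i i) (hh : h = ∑ i, ∑ j, c i j • e i j)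
    (p : ℕ) (hp : 1 ≤ p) :
    ContDiff ℝ ((⊤ : ℕ∞) : WithTop ℕ∞)
      (fun t : ℝ => LinearMap.trace ℂ H (NormedSpace.exp (x + (t : ℂ) • h) : H →L[ℂ] H)) ∧
    iteratedDeriv p
      (fun t : ℝ => LinearMap.trace ℂ H (NormedSpace.exp (x + (t : ℂ) • h) : H →L[ℂ] H)) 0 =
      (p.factorial : ℂ) * ∑ i : Fin p → Fin n,
        ((∏ k : Fin (p - 1), c (i ⟨(k : ℕ) + 1, by omega⟩) (i ⟨(k : ℕ), by omega⟩)) *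
            c (i ⟨0, by omega⟩) (i ⟨p - 1, by omega⟩)) *
          dividedDifference Complex.exp
            (List.ofFn (fun k : Fin p => lam (i k)) ++ [lam (i ⟨p - 1, by omega⟩)]) := by
  obtain ⟨p, rfl⟩ := Nat.exists_eq_add_of_le' hp
  have : CompleteSpace H := FiniteDimensional.complete ℂ H
  rw [← entireEval_exp]
  exact mainTheorem3_general he (he.operatorTrace_apply hn) Complex.differentiable_exp lam c hx hh p
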